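/- Let $k\in\mathbb R$ and $n\in\mathbb N$, and let $M_k^n$ be the model space: for $k>0$, the unit sphere $\mathbb S^n\subset\mathbb R^{n+1}$ with its angular distance $\arccos (x\mid y)$ multiplied by $1/\sqrt k$; for $k=0$, Euclidean space $\mathbb E^n$; for $k<0$, the hyperbolic space $\mathbb H^n$ (the upper hyperboloid in $\mathbb R^{n+1}$ with $\cosh d(x,y)=-\langle x\mid y\rangle$, where $\langle u\mid v\rangle=\sum_{i\le n}u_iv_i-u_{n+1}v_{n+1}$) with its distance multiplied by $1/\sqrt{-k}$. Put $D_k=\pi/\sqrt k$ if $k>0$ and $D_k=\infty$ if $k\le 0$. Let $C$ be a nonempty closed convex subset of $M_k^n$, where convex means that $C$ contains every geodesic segment joining two of its points, and let $U=\{x\in M_k^n:\operatorname{dist}(x,C)<D_k/2\}$. Then: 1. Every $x\in U$ has a unique nearest point $P_Cx$ in $C$, and a unique reflection $R_Cx$ with respect to $C$, i.e. there is exactly one point $z=R_Cx$ such that some geodesic segment from $x$ to $z$ has $P_Cx$ as its midpoint. 2. The reflection is nonexpansive: $d(R_Cx,R_Cy)\le d(x,y)$ for all $x,y\in U$. 3.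 Consequently $P_C$ is $\tfrac12$-averaged on $U$: there is a nonexpansive mapping $N:U\to M_k^n$ (namely $N=R_C$) such that for every $x\in U$ the point $P_Cx$ is a midpoint of $x$ and $Nx$, i.e. $d(x,P_Cx)=d(Nx,P_Cx)=\tfrac12 d(x,Nx)$. For $k\le 0$, $U$ is all of $M_k^n$. -/

import Mathlib

open scoped ENNReal

noncomputable section

/-! ### Geodesics, convexity, projections and reflections in a metric space -/

section MetricNotions

variable {X : Type*} [MetricSpace X]

/-- `c : [0, l] → X` is a geodesic joining `x` to `y` (values of `c` outside `[0, l]` are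
irrelevant). -/
def IsGeodesic (c : ℝ → X) (l : ℝ) (x y : X) : Prop :=
  0 ≤ l ∧ c 0 = x ∧ c l = y ∧
    ∀ s ∈ Set.Icc (0 : ℝ) l, ∀ t ∈ Set.Icc (0 : ℝ) l, dist (c s) (c t) = |s - t|

/-- `C` contains every geodesic segment joining two of its points. -/
def GeodesicConvex (C : Set X) : Prop :=
  ∀ x ∈ C, ∀ y ∈ C, ∀ (c : ℝ → X) (l : ℝ), IsGeodesic c l x y → c '' Set.Icc 0 l ⊆ C

/-- `z = (1 - t) x + t y`. -/
def IsConvexComb (t : ℝ) (x y z : X) : Prop :=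
  dist x z = t * dist x y ∧ dist y z = (1 - t) * dist x y

/-- The (set-valued) metric projection onto `C`. -/
def projSet (C : Set X) (z : X) : Set X :=
  {y | y ∈ C ∧ dist z y = Metric.infDist z C}

/-- The set of reflections of `x` with respect to `C`: points `z` such that, for some metric
projection `p` of `x` onto `C`, there is a geodesic from `x` to `z` which passes through `p`
(hence extends a geodesic segment `[x, p]` beyond `p`), and `p = (x + z) / 2`. -/
def reflSet (C : Set X) (x : X) : Set X :=
  {z | ∃ p ∈ projSet C x, ∃ (c : ℝ → X) (l : ℝ),
    IsGeodesic c l x z ∧ p ∈ c '' Set.Icc 0 l ∧ IsConvexComb (1 / 2) x z p}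

/-- `T` is `α`-averaged on `U`: `T = (1 - α) I + α N` on `U`, with `N` nonexpansive on `U`. -/
def IsAveragedOn (α : ℝ) (T : X → X) (U : Set X) : Prop :=
  ∃ N : X → X, (∀ x ∈ U, ∀ y ∈ U, dist (N x) (N y) ≤ dist x y) ∧
    ∀ x ∈ U, IsConvexComb α x (N x) (T x)

end MetricNotions

/-- The metric space obtained by multiplying the distance by `c > 0`. -/
@[reducible] def scaledMetric {X : Type} (m : MetricSpace X) (c : ℝ) (hc : 0 < c) :
    MetricSpace X where
  dist x y := c * m.dist x y
  dist_self x := by simp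
  dist_comm x y := by rw [m.dist_comm]
  dist_triangle x y z := by
    rw [← mul_add]
    exact mul_le_mul_of_nonneg_left (m.dist_triangle x y z) hc.le
  eq_of_dist_eq_zero {x y} h := by
    rcases mul_eq_zero.1 h with h | h
    · exact absurd h hc.ne'
    · exact m.eq_of_dist_eq_zero h

/-! ### The spherical space -/

/-- The sphere `{x ∈ ℝⁿ⁺¹ : (x | x) = 1}`. -/
structure SphericalSpace (n : ℕ) : Type where
  val : EuclideanSpace ℝ (Fin (n + 1))
  inner_self : inner ℝ val val = 1

namespace SphericalSpace

variable {n : ℕ}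

theorem norm_val (x : SphericalSpace n) : ‖x.val‖ = 1 := by
  have h := x.inner_self
  rw [real_inner_self_eq_norm_sq] at h
  nlinarith [norm_nonneg x.val]

theorem arccos_eq_angle (x y : SphericalSpace n) :
    Real.arccos (inner ℝ x.val y.val) = InnerProductGeometry.angle x.val y.val := by
  simp [InnerProductGeometry.angle, norm_val]

/-- The spherical distance `d(x, y) ∈ [0, π]`, `cos d(x, y) = (x | y)`. -/
instance : MetricSpace (SphericalSpace n) where
  dist x y := Real.arccos (inner ℝ x.val y.val)
  dist_self x := by
    show Real.arccos (inner ℝ x.val x.val) = 0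
    rw [x.inner_self, Real.arccos_one]
  dist_comm x y := by
    show Real.arccos (inner ℝ x.val y.val) = Real.arccos (inner ℝ y.val x.val)
    rw [real_inner_comm]
  dist_triangle x y z := by
    show Real.arccos _ ≤ Real.arccos _ + Real.arccos _
    rw [arccos_eq_angle, arccos_eq_angle, arccos_eq_angle]
    exact InnerProductGeometry.angle_le_angle_add_angle _ _ _
  eq_of_dist_eq_zero {x y} h := by
    have h' : (1 : ℝ) ≤ inner ℝ x.val y.val := Real.arccos_eq_zero.1 h
    have h1 : ‖x.val - y.val‖ ^ 2 ≤ 0 := by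
      rw [norm_sub_sq_real, norm_val, norm_val]
      linarith
    have h2 : x.val = y.val := by
      rw [← sub_eq_zero, ← norm_eq_zero]
      exact pow_eq_zero_iff two_ne_zero |>.1 (le_antisymm h1 (sq_nonneg _))
    cases x; cases y; simp_all

end SphericalSpace

/-! ### The hyperbolic space -/

/-- The quadratic form `⟨u | v⟩ = - uₙ₊₁ vₙ₊₁ + ∑ᵢ uᵢ vᵢ` on `ℝⁿ⁺¹`. -/
def lorentzForm {n : ℕ} (u v : EuclideanSpace ℝ (Fin (n + 1))) : ℝ :=
  -(u (Fin.last n) * v (Fin.last n)) + ∑ i : Fin n, u i.castSucc * v i.castSucc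

/-- The hyperboloid `{u ∈ ℝⁿ⁺¹ : ⟨u | u⟩ = -1, uₙ₊₁ > 0}`. -/
structure HyperbolicSpace (n : ℕ) : Type where
  val : EuclideanSpace ℝ (Fin (n + 1))
  form_self : lorentzForm val val = -1
  last_pos : 0 < val (Fin.last n)

namespace HyperbolicSpace

variable {n : ℕ}

theorem form_comm (u v : EuclideanSpace ℝ (Fin (n + 1))) :
    lorentzForm u v = lorentzForm v u := by
  simp only [lorentzForm, mul_comm]

theorem form_lin (a b : ℝ) (u v w : EuclideanSpace ℝ (Fin (n + 1))) :
    lorentzForm (a • u + b • v) w = a * lorentzForm u w + b * lorentzForm v w := by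
  simp only [lorentzForm, PiLp.add_apply, PiLp.smul_apply, smul_eq_mul, add_mul,
    Finset.sum_add_distrib, mul_assoc, ← Finset.mul_sum]
  ring

theorem form_lin' (a b : ℝ) (u v w : EuclideanSpace ℝ (Fin (n + 1))) :
    lorentzForm w (a • u + b • v) = a * lorentzForm w u + b * lorentzForm w v := by
  rw [form_comm, form_lin, form_comm u, form_comm v]

theorem form_sq (a b : ℝ) (u v : EuclideanSpace ℝ (Fin (n + 1))) :
    lorentzForm (a • u + b • v) (a • u + b • v) =
      a * a * lorentzForm u u + 2 * a * b * lorentzForm u v + b * b * lorentzForm v v := by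
  rw [form_lin, form_lin', form_lin', form_comm v u]
  ring

theorem orth_ineq (y : HyperbolicSpace n) (w : EuclideanSpace ℝ (Fin (n + 1)))
    (h : lorentzForm w y.val = 0) :
    w (Fin.last n) ^ 2 * y.val (Fin.last n) ^ 2 ≤
      (∑ i : Fin n, w i.castSucc ^ 2) * (y.val (Fin.last n) ^ 2 - 1) := by
  have hy := y.form_self
  simp only [lorentzForm, ← pow_two] at h hy
  have cs := Finset.sum_mul_sq_le_sq_mul_sq Finset.univ
    (fun i : Fin n => w i.castSucc) (fun i : Fin n => y.val i.castSucc)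
  have e1 : ∑ i : Fin n, w i.castSucc * y.val i.castSucc =
    w (Fin.last n) * y.val (Fin.last n) := by linarith
  have e2 : ∑ i : Fin n, y.val i.castSucc ^ 2 = y.val (Fin.last n) ^ 2 - 1 := by linarith
  rw [e1, e2] at cs
  linarith [mul_pow (w (Fin.last n)) (y.val (Fin.last n)) 2]

theorem form_self_eq (w : EuclideanSpace ℝ (Fin (n + 1))) :
    lorentzForm w w = -w (Fin.last n) ^ 2 + ∑ i : Fin n, w i.castSucc ^ 2 := by
  simp only [lorentzForm, ← pow_two]

theorem orth_nonneg (y : HyperbolicSpace n) (w : EuclideanSpace ℝ (Fin (n + 1)))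
    (h : lorentzForm w y.val = 0) : 0 ≤ lorentzForm w w := by
  have h1 := orth_ineq y w h
  have hs : 0 ≤ ∑ i : Fin n, w i.castSucc ^ 2 := Finset.sum_nonneg fun i _ => sq_nonneg _
  have hp : 0 < y.val (Fin.last n) ^ 2 := pow_pos y.last_pos 2
  rw [form_self_eq]
  have : w (Fin.last n) ^ 2 * y.val (Fin.last n) ^ 2 ≤
      (∑ i : Fin n, w i.castSucc ^ 2) * y.val (Fin.last n) ^ 2 := by nlinarith
  linarith [le_of_mul_le_mul_right this hp]

theorem orth_eq_zero (y : HyperbolicSpace n) (w : EuclideanSpace ℝ (Fin (n + 1)))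
    (h : lorentzForm w y.val = 0) (h0 : lorentzForm w w = 0) : w = 0 := by
  have h1 := orth_ineq y w h
  rw [form_self_eq] at h0
  have hs : ∑ i : Fin n, w i.castSucc ^ 2 = w (Fin.last n) ^ 2 := by linarith
  rw [hs] at h1
  have hl : w (Fin.last n) ^ 2 = 0 := le_antisymm (by linarith) (sq_nonneg _)
  rw [hl, Finset.sum_eq_zero_iff_of_nonneg (fun i _ => sq_nonneg _)] at hs
  ext i
  refine Fin.lastCases ?_ (fun j => ?_) i
  · simpa using hl
  · simpa using hs j (Finset.mem_univ j)

theorem orth_cauchy (y : HyperbolicSpace n) (u v : EuclideanSpace ℝ (Fin (n + 1)))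
    (hu : lorentzForm u y.val = 0) (hv : lorentzForm v y.val = 0) :
    lorentzForm u v ^ 2 ≤ lorentzForm u u * lorentzForm v v := by
  have key : ∀ t : ℝ, 0 ≤ lorentzForm u u * (t * t) + 2 * lorentzForm u v * t
      + lorentzForm v v := by
    intro t
    have h := orth_nonneg y (t • u + (1 : ℝ) • v) (by rw [form_lin, hu, hv]; ring)
    rw [form_sq] at h
    linarith
  have := discrim_le_zero key
  unfold discrim at this
  linarith

theorem neg_form_pos (x y : HyperbolicSpace n) : 0 < -lorentzForm x.val y.val := by
  have hx := x.form_self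
  have hy := y.form_self
  rw [form_self_eq] at hx hy
  have cs := Finset.sum_mul_sq_le_sq_mul_sq Finset.univ
    (fun i : Fin n => x.val i.castSucc) (fun i : Fin n => y.val i.castSucc)
  have e1 : ∑ i : Fin n, x.val i.castSucc ^ 2 = x.val (Fin.last n) ^ 2 - 1 := by linarith
  have e2 : ∑ i : Fin n, y.val i.castSucc ^ 2 = y.val (Fin.last n) ^ 2 - 1 := by linarith
  have px : 0 ≤ ∑ i : Fin n, x.val i.castSucc ^ 2 := Finset.sum_nonneg fun i _ => sq_nonneg _
  have py : 0 ≤ ∑ i : Fin n, y.val i.castSucc ^ 2 := Finset.sum_nonneg fun i _ => sq_nonneg _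
  rw [e1] at px
  rw [e2] at py
  rw [e1, e2] at cs
  have hlt : (∑ i : Fin n, x.val i.castSucc * y.val i.castSucc) ^ 2 <
      (x.val (Fin.last n) * y.val (Fin.last n)) ^ 2 := by
    rw [mul_pow]
    nlinarith
  have := lt_of_pow_lt_pow_left₀ 2 (mul_pos x.last_pos y.last_pos).le hlt
  simp only [lorentzForm]
  linarith

/-- The component of `x` orthogonal to `y`. -/
theorem orth_part (x y : HyperbolicSpace n) :
    lorentzForm ((1 : ℝ) • x.val + lorentzForm x.val y.val • y.val) y.val = 0 ∧
    lorentzForm ((1 : ℝ) • x.val + lorentzForm x.val y.val • y.val)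
      ((1 : ℝ) • x.val + lorentzForm x.val y.val • y.val) = lorentzForm x.val y.val ^ 2 - 1 := by
  refine ⟨?_, ?_⟩
  · rw [form_lin, y.form_self]; ring
  · rw [form_sq, x.form_self, y.form_self]; ring

theorem one_le_neg_form (x y : HyperbolicSpace n) : 1 ≤ -lorentzForm x.val y.val := by
  have h := orth_nonneg y _ (orth_part x y).1
  rw [(orth_part x y).2] at h
  nlinarith [neg_form_pos x y]

/-- The hyperbolic distance `d(x, y) ≥ 0`, `cosh d(x, y) = -⟨x | y⟩`. -/
instance : MetricSpace (HyperbolicSpace n) where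
  dist x y := Real.arcosh (-lorentzForm x.val y.val)
  dist_self x := by
    show Real.arcosh (-lorentzForm x.val x.val) = 0
    rw [x.form_self, neg_neg, Real.arcosh_zero]
  dist_comm x y := by
    show Real.arcosh (-lorentzForm x.val y.val) = Real.arcosh (-lorentzForm y.val x.val)
    rw [form_comm]
  dist_triangle x y z := by
    show Real.arcosh _ ≤ Real.arcosh _ + Real.arcosh _
    have hxy := one_le_neg_form x y
    have hzy := one_le_neg_form z y
    have hxz := one_le_neg_form x z
    rw [form_comm y.val z.val]
    have cs := orth_cauchy y _ _ (orth_part x y).1 (orth_part z y).1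
    rw [(orth_part x y).2, (orth_part z y).2, form_lin, form_lin', form_lin', y.form_self,
      form_comm y.val z.val] at cs
    have hle := Real.abs_le_sqrt cs
    rw [Real.sqrt_mul (by nlinarith)] at hle
    have hle' := (abs_le.1 hle).1
    rw [← abs_of_nonneg (Real.arcosh_nonneg hxz),
      ← abs_of_nonneg (add_nonneg (Real.arcosh_nonneg hxy) (Real.arcosh_nonneg hzy)),
      ← Real.cosh_le_cosh, Real.cosh_add, Real.cosh_arcosh hxz, Real.cosh_arcosh hxy,
      Real.cosh_arcosh hzy, Real.sinh_arcosh hxy, Real.sinh_arcosh hzy, neg_sq, neg_sq]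
    linarith
  eq_of_dist_eq_zero {x y} h := by
    have h1 : -lorentzForm x.val y.val = 1 :=
      (Real.arcosh_eq_zero_iff (one_le_neg_form x y)).1 h
    have h2 : lorentzForm x.val y.val = -1 := by linarith
    have h3 := orth_eq_zero y _ (orth_part x y).1 (by rw [(orth_part x y).2, h2]; norm_num)
    have h4 : x.val = y.val := by
      rw [h2, one_smul, neg_one_smul, ← sub_eq_add_neg, sub_eq_zero] at h3
      exact h3
    cases x; cases y; simp_all

end HyperbolicSpace

/-! ### The model spaces -/

/-- A type together with a metric. -/
structure BundledMetricSpace : Type 1 where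
  carrier : Type
  metric : MetricSpace carrier

/-- The model space `M_k^n`: the sphere with distance multiplied by `1 / √k` if `k > 0`, Euclidean
`n`-space if `k = 0`, hyperbolic `n`-space with distance multiplied by `1 / √(-k)` if `k < 0`. -/
def modelBundle (k : ℝ) (n : ℕ) : BundledMetricSpace :=
  if hpos : 0 < k then
    ⟨SphericalSpace n, scaledMetric inferInstance (1 / √k) (by positivity)⟩
  else if hneg : k < 0 then
    ⟨HyperbolicSpace n, scaledMetric inferInstance (1 / √(-k))
      (one_div_pos.2 (Real.sqrt_pos.2 (neg_pos.2 hneg)))⟩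
  else
    ⟨EuclideanSpace ℝ (Fin n), inferInstance⟩

/-- The points of `M_k^n`. -/
def ModelSpace (k : ℝ) (n : ℕ) : Type := (modelBundle k n).carrier

instance (k : ℝ) (n : ℕ) : MetricSpace (ModelSpace k n) := (modelBundle k n).metric

/-- `D_k`: `π / √k` if `k > 0` and `∞` if `k ≤ 0`. -/
def modelDiam (k : ℝ) : ℝ≥0∞ :=
  if 0 < k then ENNReal.ofReal (Real.pi / √k) else ⊤

/-- The points of `M_k^n` at distance less than `D_k / 2` from `C`. -/
def nearSet {k : ℝ} {n : ℕ} (C : Set (ModelSpace k n)) : Set (ModelSpace k n) :=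
  {x | Metric.infEDist x C < modelDiam k / 2}

end

/-! ### Reflections in an abstract metric space -/

/-! All three geometries live in a space with a bilinear form: the sphere and the hyperboloid as
level sets, Euclidean space directly. Two facts carry the proof. First, the reflection in a point
`p` is explicit: `2(x|p)p - x` on the sphere, `-2⟨x|p⟩p - x` on the hyperboloid, `2p - x` in
Euclidean space. Secondly, if `p` is a nearest point of `C` to `x` and `q ∈ C`, the first variation
along the geodesic from `p` to `q` gives `(x|q) ≤ (x|p)(p|q)`, `⟨x|q⟩ ≤ -⟨x|p⟩⟨p|q⟩`, or `(x-p|q-p)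
≤ 0`.

Uniqueness of the projection follows by taking for `q` a second nearest point. For nonexpansiveness,
the form of the two reflected points is expanded and the variation inequalities at `p` and at `q`
are inserted, which shows that it is at least the form of `x` and `y`; in the Euclidean case the
squared distance is expanded instead. On the sphere this needs `(x|p) > 0`, that is, distance below
`π/2`; on the hyperboloid the corresponding sign is automatic. -/

/-- Nonempty closed convex sets admit unique projections and unique nonexpansive reflections on
their open `r`-neighbourhood. -/
def HasNonexpansiveReflections (X : Type) [MetricSpace X] (r : ℝ≥0∞) : Prop :=
  ∀ C : Set X, C.Nonempty → IsClosed C → GeodesicConvex C →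
    ∃ P R : X → X,
      (∀ x ∈ {x | Metric.infEDist x C < r}, projSet C x = {P x}) ∧
      (∀ x ∈ {x | Metric.infEDist x C < r}, reflSet C x = {R x}) ∧
      (∀ x ∈ {x | Metric.infEDist x C < r}, ∀ y ∈ {x | Metric.infEDist x C < r},
        dist (R x) (R y) ≤ dist x y) ∧
      IsAveragedOn (1 / 2) P {x | Metric.infEDist x C < r}

/-- Properness supplies nearest points, so only pointwise facts about a candidate reflection `ρ x p`
of `x` in `p` remain. `midpoint` makes the reflection single-valued once the projection is. -/
theorem hasNonexpansiveReflections_of_pointReflection {X : Type} [MetricSpace X] [ProperSpace X]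
    {r : ℝ≥0∞} (ρ : X → X → X)
    (geodesic : ∀ x p : X, edist x p < r →
      ∃ (c : ℝ → X) (l : ℝ), IsGeodesic c l x (ρ x p) ∧ p ∈ c '' Set.Icc 0 l)
    (midpoint : ∀ x p z : X, edist x p < r → (IsConvexComb (1 / 2) x z p ↔ z = ρ x p))
    (unique : ∀ C : Set X, GeodesicConvex C → ∀ x p q : X, edist x p < r →
      p ∈ projSet C x → q ∈ projSet C x → p = q)
    (nonexpansive : ∀ C : Set X, GeodesicConvex C → ∀ x y p q : X, edist x p < r →
      edist y q < r → p ∈ projSet C x → q ∈ projSet C y → dist (ρ x p) (ρ y q) ≤ dist x y) :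
    HasNonexpansiveReflections X r := by
  intro C hne hclosed hconv
  have hex : ∀ x : X, ∃ p, p ∈ projSet C x := fun x => by
    obtain ⟨p, hp, h⟩ := hclosed.exists_infDist_eq_dist hne x
    exact ⟨p, hp, h.symm⟩
  choose P hP using hex
  have hlt : ∀ x ∈ {x | Metric.infEDist x C < r}, edist x (P x) < r := fun x hx => by
    rw [edist_dist, (hP x).2, Metric.infDist,
      ENNReal.ofReal_toReal (Metric.infEDist_ne_top hne)]
    exact hx
  have hproj : ∀ x ∈ {x | Metric.infEDist x C < r}, projSet C x = {P x} := fun x hx =>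
    Set.eq_singleton_iff_unique_mem.2 ⟨hP x, fun q hq =>
      (unique C hconv x (P x) q (hlt x hx) (hP x) hq).symm⟩
  have hmid : ∀ x ∈ {x | Metric.infEDist x C < r}, IsConvexComb (1 / 2) x (ρ x (P x)) (P x) :=
    fun x hx => (midpoint x (P x) _ (hlt x hx)).2 rfl
  have hnon : ∀ x ∈ {x | Metric.infEDist x C < r}, ∀ y ∈ {x | Metric.infEDist x C < r},
      dist (ρ x (P x)) (ρ y (P y)) ≤ dist x y := fun x hx y hy =>
    nonexpansive C hconv x y _ _ (hlt x hx) (hlt y hy) (hP x) (hP y)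
  refine ⟨P, fun x => ρ x (P x), hproj, fun x hx => ?_, hnon, fun x => ρ x (P x), hnon, hmid⟩
  refine Set.eq_singleton_iff_unique_mem.2 ⟨?_, ?_⟩
  · obtain ⟨c, l, hc, hp⟩ := geodesic x (P x) (hlt x hx)
    exact ⟨P x, hP x, c, l, hc, hp, hmid x hx⟩
  · rintro z ⟨p, hp, -, -, -, -, hz⟩
    rw [hproj x hx] at hp
    obtain rfl : p = P x := hp
    exact (midpoint x _ z (hlt x hx)).1 hz

theorem properSpace_of_dist_eq_mul {X Y : Type*} [MetricSpace X] [MetricSpace Y] [ProperSpace Y]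
    (e : X ≃ Y) {c : ℝ} (hc : 0 < c) (h : ∀ x y, dist x y = c * dist (e x) (e y)) :
    ProperSpace X := by
  have hlip : LipschitzWith c.toNNReal e.symm := LipschitzWith.of_dist_le_mul fun a b => by
    rw [h, e.apply_symm_apply, e.apply_symm_apply, Real.coe_toNNReal _ hc.le]
  refine ⟨fun x r => ?_⟩
  have : Metric.closedBall x r = e.symm '' Metric.closedBall (e x) (r / c) := by
    ext y
    rw [Set.mem_image_equiv]
    simp [h, le_div_iff₀ hc, mul_comm]
  rw [this]
  exact (isCompact_closedBall _ _).image hlip.continuous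

/-- One-sided, because the geodesic from a nearest point is known to stay in `C` in the forward
direction only. -/
theorem HasDerivAt.nonpos_of_le_right {f : ℝ → ℝ} {a s l : ℝ} (hf : HasDerivAt f s a)
    (hl : 0 < l) (h : ∀ t ∈ Set.Ioo 0 l, f (a + t) ≤ f a) : s ≤ 0 := by
  refine le_of_tendsto hf.tendsto_slope_zero_right ?_
  filter_upwards [Ioo_mem_nhdsGT hl] with t ht
  rw [smul_eq_mul]
  exact mul_nonpos_of_nonneg_of_nonpos (inv_nonneg.2 ht.1.le) (sub_nonpos.2 (h t ht))

theorem infDist_le_of_mem_projSet {X : Type*} [MetricSpace X] {C : Set X} {x p q : X}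
    (hp : p ∈ projSet C x) (hq : q ∈ C) : dist x p ≤ dist x q :=
  hp.2.trans_le (Metric.infDist_le_dist_of_mem hq)

theorem isGeodesic_const {X : Type*} [MetricSpace X] (x : X) : IsGeodesic (fun _ => x) 0 x x :=
  ⟨le_rfl, rfl, rfl, fun s hs t ht => by
    rw [le_antisymm hs.2 hs.1, le_antisymm ht.2 ht.1]; simp⟩

/-! ### Euclidean space -/

theorem isGeodesic_lineMap {E : Type*} [NormedAddCommGroup E] [NormedSpace ℝ E] (x y : E) :
    IsGeodesic (fun t => AffineMap.lineMap x y (t / dist x y)) (dist x y) x y := by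
  rcases eq_or_ne x y with rfl | hxy
  · simpa using isGeodesic_const x
  have hd : 0 < dist x y := dist_pos.2 hxy
  refine ⟨hd.le, by simp, by simp [div_self hd.ne'], fun s _ t _ => ?_⟩
  rw [dist_lineMap_lineMap, Real.dist_eq, ← sub_div, abs_div, abs_of_pos hd,
    div_mul_cancel₀ _ hd.ne']

theorem euclidean_inner_le_zero {n : ℕ} {C : Set (EuclideanSpace ℝ (Fin n))}
    (hC : GeodesicConvex C) {x p q : EuclideanSpace ℝ (Fin n)} (hp : p ∈ projSet C x)
    (hq : q ∈ C) : inner ℝ (x - p) (q - p) ≤ 0 := by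
  -- Affine segments, parametrised by arc length, are geodesics; hence linear convexity, and the
  -- classical variational inequality applies.
  have hconv : Convex ℝ C := by
    refine convex_iff_segment_subset.2 fun a ha b hb => ?_
    rw [segment_eq_image_lineMap]
    rintro _ ⟨t, ht, rfl⟩
    rcases eq_or_ne a b with rfl | hab
    · simpa using ha
    refine hC a ha b hb _ _ (isGeodesic_lineMap a b) ⟨t * dist a b, ⟨by have := ht.1; positivity,
      mul_le_of_le_one_left dist_nonneg ht.2⟩, ?_⟩
    simp [mul_div_cancel_right₀ _ (dist_ne_zero.2 hab)]
  refine (norm_eq_iInf_iff_real_inner_le_zero hconv hp.1).1 ?_ q hq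
  rw [← dist_eq_norm, hp.2, Metric.infDist_eq_iInf]
  simp only [dist_eq_norm]

theorem euclideanSpace_hasNonexpansiveReflections (n : ℕ) (r : ℝ≥0∞) :
    HasNonexpansiveReflections (EuclideanSpace ℝ (Fin n)) r := by
  refine hasNonexpansiveReflections_of_pointReflection (fun x p => p + p - x) ?_ ?_ ?_ ?_
  · intro x p _
    refine ⟨_, _, isGeodesic_lineMap x (p + p - x), dist x p, ⟨dist_nonneg, ?_⟩, ?_⟩
    all_goals
      have h : dist x (p + p - x) = 2 * dist x p := by
        rw [dist_eq_norm, dist_eq_norm, show x - (p + p - x) = (2 : ℝ) • (x - p) by module,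
          norm_smul]
        simp
    · rw [h]; linarith [dist_nonneg (x := x) (y := p)]
    · rcases eq_or_ne x p with rfl | hxp
      · simp
      · have := dist_ne_zero.2 hxp
        simp only [h, AffineMap.lineMap_apply_module]
        rw [show dist x p / (2 * dist x p) = 1 / 2 by field_simp]
        module
  · intro x p z _
    constructor
    · rintro ⟨h1, h2⟩
      have := eq_midpoint_of_dist_eq_half (x := x) (y := p) (z := z)
        (by rw [h1]; ring) (by rw [dist_comm, h2]; ring)
      rw [this, ← two_smul ℝ, midpoint_eq_smul_add]
      simp
    · rintro rfl
      have h : ‖x - (p + p - x)‖ = 2 * ‖x - p‖ := by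
        rw [show x - (p + p - x) = (2 : ℝ) • (x - p) by module, norm_smul]
        simp
      refine ⟨?_, ?_⟩
      · rw [dist_eq_norm, dist_eq_norm, h]; ring
      · rw [dist_eq_norm, dist_eq_norm, h, norm_sub_rev x p,
          show p + p - x - p = p - x by abel]; ring
  -- The two variational inequalities add up to `‖p - q‖² ≤ 0`.
  · intro C hC x p q _ hp hq
    have h1 := euclidean_inner_le_zero hC hp hq.1
    have h2 := euclidean_inner_le_zero hC hq hp.1
    rw [← sub_eq_zero, ← inner_self_eq_zero (𝕜 := ℝ)]
    refine le_antisymm ?_ real_inner_self_nonneg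
    simp only [inner_sub_left, inner_sub_right] at h1 h2 ⊢
    linarith [real_inner_comm p q]
  -- The sum of `h1` and `h2` is firm nonexpansiveness, `‖p - q‖² ≤ (p - q | x - y)`; expanding
  -- `‖2(p - q) - (x - y)‖²` then finishes.
  · intro C hC x y p q _ _ hp hq
    have h1 := euclidean_inner_le_zero hC hp hq.1
    have h2 := euclidean_inner_le_zero hC hq hp.1
    rw [dist_eq_norm, dist_eq_norm, ← sq_le_sq₀ (norm_nonneg _) (norm_nonneg _),
      ← real_inner_self_eq_norm_sq, ← real_inner_self_eq_norm_sq]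
    simp only [inner_sub_left, inner_sub_right, inner_add_left, inner_add_right] at h1 h2 ⊢
    linarith [real_inner_comm p q, real_inner_comm x p, real_inner_comm x q, real_inner_comm y p,
      real_inner_comm y q, real_inner_comm x y]

/-! ### The sphere -/

namespace SphericalSpace

variable {n : ℕ}

theorem ext_val {x y : SphericalSpace n} (h : x.val = y.val) : x = y := by
  cases x; cases y; simp_all

theorem dist_def (x y : SphericalSpace n) : dist x y = Real.arccos (inner ℝ x.val y.val) := rfl

theorem cos_dist (x y : SphericalSpace n) : Real.cos (dist x y) = inner ℝ x.val y.val := by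
  have h := abs_real_inner_le_norm x.val y.val
  rw [norm_val, norm_val, one_mul, abs_le] at h
  exact Real.cos_arccos h.1 h.2

theorem dist_le_pi (x y : SphericalSpace n) : dist x y ≤ Real.pi := Real.arccos_le_pi _

/-- The topology comes from the angular distance, so continuity of the map from the norm sphere is
checked through that distance. -/
instance : CompactSpace (SphericalSpace n) := by
  let f : Metric.sphere (0 : EuclideanSpace ℝ (Fin (n + 1))) 1 → SphericalSpace n := fun v =>
    ⟨v, by rw [real_inner_self_eq_norm_sq, norm_eq_of_mem_sphere v]; norm_num⟩
  have hf : Continuous f := by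
    refine continuous_iff_continuousAt.2 fun v => tendsto_iff_dist_tendsto_zero.2 ?_
    have h : Continuous fun w => dist (f w) (f v) := by
      change Continuous fun w : Metric.sphere (0 : EuclideanSpace ℝ (Fin (n + 1))) 1 =>
        Real.arccos (inner ℝ w.1 v.1)
      fun_prop
    simpa using h.tendsto v
  have hs : Function.Surjective f := fun x =>
    ⟨⟨x.val, by simp [norm_val]⟩, rfl⟩
  have : CompactSpace (Metric.sphere (0 : EuclideanSpace ℝ (Fin (n + 1))) 1) :=
    isCompact_iff_compactSpace.1 (isCompact_sphere _ _)
  exact hs.compactSpace hf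

/-- The point `cos t • x + sin t • w` of the great circle through `x` in the direction `w`. -/
noncomputable def ray (x : SphericalSpace n) (w : EuclideanSpace ℝ (Fin (n + 1))) (hw : inner ℝ w w = (1 : ℝ))
    (hxw : inner ℝ x.val w = (0 : ℝ)) (t : ℝ) : SphericalSpace n :=
  ⟨Real.cos t • x.val + Real.sin t • w, by
    have := x.inner_self
    simp only [inner_add_left, inner_add_right, inner_smul_left, inner_smul_right,
      real_inner_comm x.val w, hw, hxw, this]
    simp only [conj_trivial]
    linarith [Real.sin_sq_add_cos_sq t]⟩

theorem dist_ray (x : SphericalSpace n) (w : EuclideanSpace ℝ (Fin (n + 1)))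
    (hw : inner ℝ w w = (1 : ℝ)) (hxw : inner ℝ x.val w = (0 : ℝ)) {s t : ℝ}
    (h : |s - t| ≤ Real.pi) : dist (ray x w hw hxw s) (ray x w hw hxw t) = |s - t| := by
  rw [dist_def, ← Real.arccos_cos (abs_nonneg _) h, Real.cos_abs, Real.cos_sub]
  congr 1
  have := x.inner_self
  simp only [ray, inner_add_left, inner_add_right, inner_smul_left, inner_smul_right,
    real_inner_comm x.val w, hw, hxw, this]
  simp only [conj_trivial]
  ring

/-- `w` is the normalised component of `p` orthogonal to `x`; the endpoints `0` and `π` are excluded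
since the sine vanishes there. -/
theorem exists_direction (x p : SphericalSpace n) (h0 : 0 < dist x p) (h1 : dist x p < Real.pi) :
    ∃ (w : EuclideanSpace ℝ (Fin (n + 1))) (_ : inner ℝ w w = (1 : ℝ))
      (_ : inner ℝ x.val w = (0 : ℝ)),
      p.val = Real.cos (dist x p) • x.val + Real.sin (dist x p) • w := by
  have hs : Real.sin (dist x p) ≠ 0 := (Real.sin_pos_of_pos_of_lt_pi h0 h1).ne'
  refine ⟨(Real.sin (dist x p))⁻¹ • (p.val - Real.cos (dist x p) • x.val), ?_, ?_, ?_⟩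
  · simp only [inner_sub_left, inner_sub_right, inner_smul_left, inner_smul_right,
      real_inner_comm x.val p.val, x.inner_self, p.inner_self, ← cos_dist, conj_trivial]
    field_simp
    linarith [Real.sin_sq_add_cos_sq (dist x p)]
  · simp only [inner_sub_right, inner_smul_right, x.inner_self, ← cos_dist]
    simp
  · rw [smul_inv_smul₀ hs]
    abel

/-- The reflection of `x` in the point `p`. -/
noncomputable def pointReflection (x p : SphericalSpace n) : SphericalSpace n :=
  ⟨(2 * inner ℝ x.val p.val : ℝ) • p.val - x.val, by
    simp only [inner_sub_left, inner_sub_right, inner_smul_left, inner_smul_right,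
      real_inner_comm x.val p.val, x.inner_self, p.inner_self, conj_trivial]
    ring⟩

theorem ray_two_mul_dist {x p : SphericalSpace n} {w : EuclideanSpace ℝ (Fin (n + 1))}
    (hw : inner ℝ w w = (1 : ℝ)) (hxw : inner ℝ x.val w = (0 : ℝ))
    (hp : p.val = Real.cos (dist x p) • x.val + Real.sin (dist x p) • w) :
    ray x w hw hxw (2 * dist x p) = pointReflection x p := by
  refine ext_val ?_
  simp only [ray, pointReflection, ← cos_dist]
  rw [Real.cos_two_mul, Real.sin_two_mul]
  rw [hp]
  module

theorem dist_pointReflection_left {x p : SphericalSpace n} (h : dist x p ≤ Real.pi / 2) :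
    dist x (pointReflection x p) = 2 * dist x p := by
  rw [dist_def x (pointReflection x p), ← Real.arccos_cos (x := 2 * dist x p)
    (by positivity) (by linarith), Real.cos_two_mul, cos_dist]
  simp only [pointReflection, inner_sub_right, inner_smul_right, x.inner_self]
  congr 1
  ring

theorem dist_pointReflection_right (x p : SphericalSpace n) :
    dist (pointReflection x p) p = dist x p := by
  rw [dist_def, dist_def]
  simp only [pointReflection, inner_sub_left, inner_smul_left, p.inner_self, conj_trivial]
  congr 1
  ring

/-- With `d = dist x p`, the inner product of `z` with the reflection is `2 cos² d - cos 2d = 1`,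
which forces equality of unit vectors. -/
theorem eq_pointReflection {x p z : SphericalSpace n} (h1 : dist x z = 2 * dist x p)
    (h2 : dist z p = dist x p) : z = pointReflection x p := by
  refine dist_eq_zero.1 ?_
  rw [dist_def, Real.arccos_eq_zero]
  simp only [pointReflection, inner_sub_right, inner_smul_right, real_inner_comm x.val z.val]
  rw [← cos_dist, ← cos_dist, ← cos_dist, h1, h2, Real.cos_two_mul]
  linarith

/-! ### First variation and reflections on a rescaled sphere -/

section Scaled

variable {X : Type} [MetricSpace X] {c : ℝ} (e : X ≃ SphericalSpace n)

theorem isGeodesic_ray (hc : 0 < c) (he : ∀ x y, dist x y = c * dist (e x) (e y))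
    (x : SphericalSpace n) (w : EuclideanSpace ℝ (Fin (n + 1)))
    (hw : inner ℝ w w = (1 : ℝ)) (hxw : inner ℝ x.val w = (0 : ℝ)) {l : ℝ} (h0 : 0 ≤ l)
    (hl : l ≤ Real.pi) :
    IsGeodesic (fun t => e.symm (ray x w hw hxw (t / c))) (c * l) (e.symm x)
      (e.symm (ray x w hw hxw l)) := by
  refine ⟨by positivity, ?_, by simp [hc.ne'], fun s hs t ht => ?_⟩
  · simp only [EmbeddingLike.apply_eq_iff_eq]
    exact ext_val (by simp [ray])
  · have h : |s / c - t / c| * c = |s - t| := by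
      rw [← sub_div, abs_div, abs_of_pos hc, div_mul_cancel₀ _ hc.ne']
    have h' : |s - t| ≤ c * l := abs_le.2 ⟨by linarith [hs.1, ht.2], by linarith [hs.2, ht.1]⟩
    rw [he, e.apply_symm_apply, e.apply_symm_apply, dist_ray, mul_comm, h]
    rw [← h, mul_comm] at h'
    exact (le_of_mul_le_mul_left h' hc).trans hl

/-- The first variation inequality at a nearest point. -/
theorem inner_le_of_mem_projSet (hc : 0 < c) (he : ∀ x y, dist x y = c * dist (e x) (e y))
    {C : Set X} (hC : GeodesicConvex C) {x p q : X} (hp : p ∈ projSet C x) (hq : q ∈ C) :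
    inner ℝ (e x).val (e q).val ≤ inner ℝ (e x).val (e p).val * inner ℝ (e p).val (e q).val := by
  rcases eq_or_lt_of_le (dist_nonneg (x := e p) (y := e q)) with h0 | h0
  · rw [dist_eq_zero.1 h0.symm, (e q).inner_self, mul_one]
  -- Antipodal points determine no direction, but then `q = -p` and the claim is an equality.
  rcases eq_or_lt_of_le (dist_le_pi (e p) (e q)) with h1 | h1
  · have hpq : inner ℝ (e p).val (e q).val = (-1 : ℝ) := by rw [← cos_dist, h1, Real.cos_pi]
    have : (e p).val + (e q).val = 0 := by
      rw [← inner_self_eq_zero (𝕜 := ℝ)]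
      simp only [inner_add_left, inner_add_right, real_inner_comm (e p).val (e q).val,
        (e p).inner_self, (e q).inner_self, hpq]
      norm_num
    rw [hpq, eq_neg_of_add_eq_zero_right this, inner_neg_right, mul_neg_one]
  obtain ⟨w, hw, hpw, h⟩ := exists_direction (e p) (e q) h0 h1
  -- Along the ray from `p` to `q` the inner product with `x` is largest at `t = 0`, as `p` is
  -- nearest; its derivative there is `(x|w)`.
  have hs : inner ℝ (e x).val w ≤ (0 : ℝ) := by
    refine HasDerivAt.nonpos_of_le_right (a := 0) (l := dist (e p) (e q))
      (f := fun t => Real.cos t * inner ℝ (e x).val (e p).val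
        + Real.sin t * inner ℝ (e x).val w) ?_ h0 fun t ht => ?_
    · refine (((Real.hasDerivAt_cos 0).mul_const _).add
        ((Real.hasDerivAt_sin 0).mul_const _)).congr_deriv ?_
      simp
    · have hray : ray (e p) w hw hpw (dist (e p) (e q)) = e q := ext_val h.symm
      have hg := isGeodesic_ray e hc he (e p) w hw hpw h0.le h1.le
      rw [hray, e.symm_apply_apply, e.symm_apply_apply] at hg
      have hm : e.symm (ray (e p) w hw hpw t) ∈ C := hC p hp.1 q hq _ _ hg
        ⟨c * t, ⟨by have := ht.1; positivity, by have := ht.2.le; gcongr⟩, by simp [hc.ne']⟩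
      have hle := infDist_le_of_mem_projSet hp hm
      rw [he, he, e.apply_symm_apply] at hle
      have hcos := Real.cos_le_cos_of_nonneg_of_le_pi dist_nonneg (dist_le_pi _ _)
        (le_of_mul_le_mul_left hle hc)
      rw [cos_dist, cos_dist] at hcos
      simpa [ray, inner_add_right, inner_smul_right] using hcos
  have hsin : 0 < Real.sin (dist (e p) (e q)) := Real.sin_pos_of_pos_of_lt_pi h0 h1
  rw [← cos_dist (e p) (e q), h, inner_add_right, inner_smul_right, inner_smul_right]
  nlinarith

theorem hasNonexpansiveReflections (hc : 0 < c)
    (he : ∀ x y, dist x y = c * dist (e x) (e y)) :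
    HasNonexpansiveReflections X (ENNReal.ofReal (c * (Real.pi / 2))) := by
  have := properSpace_of_dist_eq_mul e hc he
  have hlt : ∀ {x p : X}, edist x p < ENNReal.ofReal (c * (Real.pi / 2)) →
      dist (e x) (e p) < Real.pi / 2 := fun {x p} h => by
    rw [edist_dist, he] at h
    exact lt_of_mul_lt_mul_left (ENNReal.ofReal_lt_ofReal_iff_of_nonneg (by positivity) |>.1 h)
      hc.le
  have hpos : ∀ {x p : X}, edist x p < ENNReal.ofReal (c * (Real.pi / 2)) →
      0 < (inner ℝ (e x).val (e p).val : ℝ) := fun {x p} h => by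
    rw [← cos_dist]
    exact Real.cos_pos_of_mem_Ioo
      ⟨by linarith [dist_nonneg (x := e x) (y := e p), Real.pi_pos], hlt h⟩
  refine hasNonexpansiveReflections_of_pointReflection
    (fun x p => e.symm (pointReflection (e x) (e p))) ?_ ?_ ?_ ?_
  · intro x p h
    rcases eq_or_lt_of_le (dist_nonneg (x := e x) (y := e p)) with h0 | h0
    · obtain rfl : x = p := e.injective (dist_eq_zero.1 h0.symm)
      have hx : e.symm (pointReflection (e x) (e x)) = x := by
        rw [Equiv.symm_apply_eq]
        exact (eq_pointReflection (by simp) rfl).symm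
      rw [hx]
      exact ⟨_, _, isGeodesic_const x, 0, by simp, rfl⟩
    · have h1 := hlt h
      obtain ⟨w, hw, hxw, hp⟩ := exists_direction (e x) (e p) h0 (by linarith)
      have hg := isGeodesic_ray e hc he (e x) w hw hxw (l := 2 * dist (e x) (e p))
        (by positivity) (by linarith)
      rw [ray_two_mul_dist hw hxw hp, e.symm_apply_apply] at hg
      refine ⟨_, _, hg, c * dist (e x) (e p), ⟨by positivity, by gcongr; linarith⟩, ?_⟩
      simp only [mul_div_cancel_left₀ _ hc.ne']
      rw [Equiv.symm_apply_eq]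
      exact ext_val hp.symm
  · intro x p z h
    rw [IsConvexComb, he, he, he, Equiv.eq_symm_apply]
    constructor
    · rintro ⟨h1, h2⟩
      refine eq_pointReflection (mul_left_cancel₀ hc.ne' ?_) (mul_left_cancel₀ hc.ne' ?_) <;>
        linarith
    · intro hz
      rw [hz, dist_pointReflection_left (hlt h).le, dist_pointReflection_right]
      constructor <;> ring
  -- Equidistance turns the variation inequality into `(x|p) ≤ (x|p)(p|q)`; cancelling `(x|p) > 0`
  -- leaves `(p|q) ≥ 1`.
  · intro C hC x p q h hp hq
    have hle := inner_le_of_mem_projSet e hc he hC hp hq.1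
    have hxq : dist x q = dist x p := hq.2.trans hp.2.symm
    rw [he, he] at hxq
    rw [← cos_dist (e x) (e q), mul_left_cancel₀ hc.ne' hxq, cos_dist] at hle
    refine e.injective (dist_eq_zero.1 ?_)
    rw [dist_def, Real.arccos_eq_zero]
    exact (le_mul_iff_one_le_right (hpos h)).1 hle
  · intro C hC x y p q h h' hp hq
    have h1 := inner_le_of_mem_projSet e hc he hC hp hq.1
    have h2 := inner_le_of_mem_projSet e hc he hC hq hp.1
    rw [he, he, e.apply_symm_apply, e.apply_symm_apply]
    refine mul_le_mul_of_nonneg_left (Real.arccos_le_arccos ?_) hc.le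
    simp only [pointReflection, inner_sub_left, inner_sub_right, inner_smul_left,
      inner_smul_right, conj_trivial]
    rw [real_inner_comm (e p).val (e q).val] at h2
    rw [real_inner_comm (e y).val (e p).val]
    -- Both products are bounded by `(x|p)(y|q)(p|q)`, which compensates the cross terms of the
    -- expanded inner product.
    have h3 := mul_le_mul_of_nonneg_left h1 (hpos h').le
    have h4 := mul_le_mul_of_nonneg_left h2 (hpos h).le
    linarith

end Scaled

end SphericalSpace

/-! ### Hyperbolic space -/

namespace HyperbolicSpace

variable {n : ℕ}

theorem ext_val {x y : HyperbolicSpace n} (h : x.val = y.val) : x = y := by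
  cases x; cases y; simp_all

theorem dist_def (x y : HyperbolicSpace n) :
    dist x y = Real.arcosh (-lorentzForm x.val y.val) := rfl

theorem cosh_dist (x y : HyperbolicSpace n) :
    Real.cosh (dist x y) = -lorentzForm x.val y.val :=
  Real.cosh_arcosh (one_le_neg_form x y)

theorem form_eq (x y : HyperbolicSpace n) :
    lorentzForm x.val y.val = -Real.cosh (dist x y) := by
  rw [cosh_dist, neg_neg]

/-- Separates the two sheets: if `v` were on the lower one, `-v` would be a point with `⟨x|-v⟩ > 0`,
against `one_le_neg_form`. -/
theorem last_pos_of_form_neg (x : HyperbolicSpace n) {v : EuclideanSpace ℝ (Fin (n + 1))}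
    (hv : lorentzForm v v = -1) (hxv : lorentzForm x.val v < 0) : 0 < v (Fin.last n) := by
  by_contra! hle
  rcases eq_or_lt_of_le hle with h0 | h0
  · rw [form_self_eq, h0] at hv
    have : 0 ≤ ∑ i : Fin n, v i.castSucc ^ 2 := Finset.sum_nonneg fun i _ => sq_nonneg _
    linarith
  · have := one_le_neg_form x ⟨(-1 : ℝ) • v + (0 : ℝ) • v, by rw [form_sq, hv]; ring,
      by simpa using h0⟩
    rw [form_lin'] at this
    linarith

theorem continuous_form (x : EuclideanSpace ℝ (Fin (n + 1))) :
    Continuous fun v => lorentzForm x v := by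
  unfold lorentzForm
  fun_prop

theorem continuous_form_self :
    Continuous fun v : EuclideanSpace ℝ (Fin (n + 1)) => lorentzForm v v := by
  unfold lorentzForm
  fun_prop

/-- The point `(0, …, 0, 1)`. -/
noncomputable def origin (n : ℕ) : HyperbolicSpace n :=
  ⟨EuclideanSpace.single (Fin.last n) 1, by simp [lorentzForm], by simp⟩

theorem cosh_dist_origin (x : HyperbolicSpace n) :
    Real.cosh (dist x (origin n)) = x.val (Fin.last n) := by
  rw [cosh_dist]
  simp [lorentzForm, origin]

/-- On the hyperboloid `‖v‖² = 2 vₙ₊₁² - 1`, so a bounded last coordinate bounds the vector. The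
weak inequality `0 ≤ vₙ₊₁` keeps the set closed. -/
theorem isCompact_form_self_last_le (b : ℝ) :
    IsCompact {v : EuclideanSpace ℝ (Fin (n + 1)) |
      lorentzForm v v = -1 ∧ 0 ≤ v (Fin.last n) ∧ v (Fin.last n) ≤ b} := by
  refine Metric.isCompact_of_isClosed_isBounded ?_ ?_
  · have hl : Continuous fun v : EuclideanSpace ℝ (Fin (n + 1)) => v (Fin.last n) := by fun_prop
    exact (isClosed_eq continuous_form_self continuous_const).inter
      ((isClosed_le continuous_const hl).inter (isClosed_le hl continuous_const))
  · refine (Metric.isBounded_closedBall (x := 0) (r := 2 * b)).subset ?_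
    rintro v ⟨h1, h2, h3⟩
    rw [form_self_eq] at h1
    rw [mem_closedBall_zero_iff]
    refine le_of_sq_le_sq ?_ (by linarith)
    rw [EuclideanSpace.norm_sq_eq, Fin.sum_univ_castSucc]
    simp only [Real.norm_eq_abs, sq_abs]
    nlinarith

instance : ProperSpace (HyperbolicSpace n) := by
  let S (b : ℝ) : Set (EuclideanSpace ℝ (Fin (n + 1))) :=
    {v | lorentzForm v v = -1 ∧ 0 ≤ v (Fin.last n) ∧ v (Fin.last n) ≤ b}
  have hpos : ∀ {v : EuclideanSpace ℝ (Fin (n + 1))}, lorentzForm v v = -1 →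
      0 ≤ v (Fin.last n) → 0 < v (Fin.last n) := fun {v} h1 h2 => by
    refine lt_of_le_of_ne h2 fun h0 => ?_
    rw [form_self_eq, ← h0] at h1
    have : 0 ≤ ∑ i : Fin n, v i.castSucc ^ 2 := Finset.sum_nonneg fun i _ => sq_nonneg _
    linarith
  let f (b : ℝ) : S b → HyperbolicSpace n := fun v => ⟨v, v.2.1, hpos v.2.1 v.2.2.1⟩
  have hf : ∀ b, Continuous (f b) := fun b => by
    refine continuous_iff_continuousAt.2 fun v => tendsto_iff_dist_tendsto_zero.2 ?_
    have h : Continuous fun w => dist (f b w) (f b v) := by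
      have : (fun w => dist (f b w) (f b v)) =
          fun w : S b => Real.arcosh (-lorentzForm v.1 w.1) := by
        funext w
        rw [dist_comm]
        rfl
      rw [this]
      exact Real.continuousOn_arcosh.comp_continuous
        ((continuous_form v.1).comp continuous_subtype_val).neg
        fun w => one_le_neg_form (f b v) (f b w)
    simpa using h.tendsto v
  -- The last coordinate of `y` is `cosh` of its distance to the origin, so a ball lies in the image
  -- of one compact slice.
  refine ProperSpace.of_isCompact_closedBall_of_le 0 fun x r _ => ?_
  have : CompactSpace (S (Real.cosh (r + dist x (origin n)))) :=
    isCompact_iff_compactSpace.1 (isCompact_form_self_last_le _)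
  refine (isCompact_range (hf (Real.cosh (r + dist x (origin n))))).of_isClosed_subset
    Metric.isClosed_closedBall fun y hy => ?_
  refine ⟨⟨y.val, y.form_self, y.last_pos.le, ?_⟩, rfl⟩
  rw [← cosh_dist_origin, Real.cosh_le_cosh, abs_of_nonneg dist_nonneg]
  refine le_trans ?_ (le_abs_self _)
  linarith [dist_triangle y x (origin n), Metric.mem_closedBall.1 hy]

/-- The point `cosh t • x + sinh t • w` of the hyperbolic line through `x` in the direction
`w`. -/
noncomputable def ray (x : HyperbolicSpace n) (w : EuclideanSpace ℝ (Fin (n + 1)))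
    (hw : lorentzForm w w = 1) (hxw : lorentzForm x.val w = 0) (t : ℝ) : HyperbolicSpace n :=
  have h : lorentzForm (Real.cosh t • x.val + Real.sinh t • w)
      (Real.cosh t • x.val + Real.sinh t • w) = -1 := by
    rw [form_sq, x.form_self, hw, hxw]
    linarith [Real.cosh_sq t]
  ⟨Real.cosh t • x.val + Real.sinh t • w, h, last_pos_of_form_neg x h (by
    rw [form_lin', x.form_self, hxw]
    linarith [Real.cosh_pos t])⟩

theorem dist_ray (x : HyperbolicSpace n) (w : EuclideanSpace ℝ (Fin (n + 1)))
    (hw : lorentzForm w w = 1) (hxw : lorentzForm x.val w = 0) (s t : ℝ) :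
    dist (ray x w hw hxw s) (ray x w hw hxw t) = |s - t| := by
  rw [dist_def, ← Real.arcosh_cosh (abs_nonneg _), Real.cosh_abs, Real.cosh_sub]
  congr 1
  simp only [ray]
  rw [form_lin, form_lin', form_lin', form_comm w, x.form_self, hw, hxw]
  ring

theorem exists_direction (x p : HyperbolicSpace n) (h0 : 0 < dist x p) :
    ∃ (w : EuclideanSpace ℝ (Fin (n + 1))) (_ : lorentzForm w w = 1)
      (_ : lorentzForm x.val w = 0),
      p.val = Real.cosh (dist x p) • x.val + Real.sinh (dist x p) • w := by
  have hs : Real.sinh (dist x p) ≠ 0 := (Real.sinh_pos_iff.2 h0).ne'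
  refine ⟨(Real.sinh (dist x p))⁻¹ • p.val +
    (-((Real.sinh (dist x p))⁻¹ * Real.cosh (dist x p))) • x.val, ?_, ?_, ?_⟩
  · rw [form_sq, form_comm p.val x.val, form_eq x p, x.form_self, p.form_self]
    field_simp
    linarith [Real.cosh_sq (dist x p)]
  · rw [form_lin', form_eq, x.form_self]
    ring
  · rw [smul_add, smul_inv_smul₀ hs, smul_smul, mul_neg, mul_inv_cancel_left₀ hs]
    module

/-- The reflection of `x` in the point `p`. -/
noncomputable def pointReflection (x p : HyperbolicSpace n) : HyperbolicSpace n :=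
  have h : lorentzForm ((-(2 * lorentzForm x.val p.val)) • p.val + (-1 : ℝ) • x.val)
      ((-(2 * lorentzForm x.val p.val)) • p.val + (-1 : ℝ) • x.val) = -1 := by
    rw [form_sq, form_comm p.val x.val, p.form_self, x.form_self]
    ring
  ⟨_, h, last_pos_of_form_neg p h (by
    rw [form_lin', form_comm p.val x.val, p.form_self]
    linarith [neg_form_pos x p])⟩

theorem ray_two_mul_dist {x p : HyperbolicSpace n} {w : EuclideanSpace ℝ (Fin (n + 1))}
    (hw : lorentzForm w w = 1) (hxw : lorentzForm x.val w = 0)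
    (hp : p.val = Real.cosh (dist x p) • x.val + Real.sinh (dist x p) • w) :
    ray x w hw hxw (2 * dist x p) = pointReflection x p := by
  refine ext_val ?_
  simp only [ray, pointReflection, form_eq]
  rw [Real.cosh_two_mul, Real.sinh_two_mul, hp, Real.sinh_sq]
  module

theorem dist_pointReflection_left (x p : HyperbolicSpace n) :
    dist x (pointReflection x p) = 2 * dist x p := by
  rw [dist_def x (pointReflection x p), ← Real.arcosh_cosh (x := 2 * dist x p)
    (by positivity), Real.cosh_two_mul, Real.sinh_sq, cosh_dist]
  simp only [pointReflection, form_lin', x.form_self]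
  congr 1
  ring

theorem dist_pointReflection_right (x p : HyperbolicSpace n) :
    dist (pointReflection x p) p = dist x p := by
  rw [dist_def, dist_def]
  simp only [pointReflection, form_lin, p.form_self]
  congr 1
  ring

theorem eq_pointReflection {x p z : HyperbolicSpace n} (h1 : dist x z = 2 * dist x p)
    (h2 : dist z p = dist x p) : z = pointReflection x p := by
  refine dist_eq_zero.1 ?_
  rw [dist_def, Real.arcosh_eq_zero_iff (one_le_neg_form _ _)]
  simp only [pointReflection, form_lin', form_comm z.val x.val, form_eq, h1, h2,
    Real.cosh_two_mul, Real.sinh_sq]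
  ring

/-! ### First variation and reflections on a rescaled hyperboloid -/

section Scaled

variable {X : Type} [MetricSpace X] {c : ℝ} (e : X ≃ HyperbolicSpace n)

theorem isGeodesic_ray (hc : 0 < c) (he : ∀ x y, dist x y = c * dist (e x) (e y))
    (x : HyperbolicSpace n) (w : EuclideanSpace ℝ (Fin (n + 1)))
    (hw : lorentzForm w w = 1) (hxw : lorentzForm x.val w = 0) {l : ℝ} (h0 : 0 ≤ l) :
    IsGeodesic (fun t => e.symm (ray x w hw hxw (t / c))) (c * l) (e.symm x)
      (e.symm (ray x w hw hxw l)) := by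
  refine ⟨by positivity, ?_, by simp [hc.ne'], fun s _ t _ => ?_⟩
  · simp only [EmbeddingLike.apply_eq_iff_eq]
    exact ext_val (by simp [ray])
  · rw [he, e.apply_symm_apply, e.apply_symm_apply, dist_ray, ← sub_div, abs_div,
      abs_of_pos hc, mul_div_cancel₀ _ hc.ne']

/-- The first variation inequality at a nearest point. -/
theorem form_le_of_mem_projSet (hc : 0 < c) (he : ∀ x y, dist x y = c * dist (e x) (e y))
    {C : Set X} (hC : GeodesicConvex C) {x p q : X} (hp : p ∈ projSet C x) (hq : q ∈ C) :
    lorentzForm (e x).val (e q).val ≤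
      -lorentzForm (e x).val (e p).val * lorentzForm (e p).val (e q).val := by
  rcases eq_or_lt_of_le (dist_nonneg (x := e p) (y := e q)) with h0 | h0
  · rw [dist_eq_zero.1 h0.symm, (e q).form_self, neg_mul_neg, mul_one]
  obtain ⟨w, hw, hpw, h⟩ := exists_direction (e p) (e q) h0
  -- Minimal distance means minimal `cosh`, hence maximal form, at `t = 0`; the derivative there is
  -- `⟨x|w⟩`.
  have hs : lorentzForm (e x).val w ≤ 0 := by
    refine HasDerivAt.nonpos_of_le_right (a := 0) (l := dist (e p) (e q))
      (f := fun t => Real.cosh t * lorentzForm (e x).val (e p).val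
        + Real.sinh t * lorentzForm (e x).val w) ?_ h0 fun t ht => ?_
    · refine (((Real.hasDerivAt_cosh 0).mul_const _).add
        ((Real.hasDerivAt_sinh 0).mul_const _)).congr_deriv ?_
      simp
    · have hray : ray (e p) w hw hpw (dist (e p) (e q)) = e q := ext_val h.symm
      have hg := isGeodesic_ray e hc he (e p) w hw hpw h0.le
      rw [hray, e.symm_apply_apply, e.symm_apply_apply] at hg
      have hm : e.symm (ray (e p) w hw hpw t) ∈ C := hC p hp.1 q hq _ _ hg
        ⟨c * t, ⟨by have := ht.1; positivity, by have := ht.2.le; gcongr⟩, by simp [hc.ne']⟩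
      have hle := infDist_le_of_mem_projSet hp hm
      rw [he, he, e.apply_symm_apply] at hle
      have hcosh := Real.cosh_le_cosh.2 (abs_le_abs_of_nonneg dist_nonneg
        (le_of_mul_le_mul_left hle hc))
      rw [cosh_dist, cosh_dist, neg_le_neg_iff] at hcosh
      simpa [ray, form_lin'] using hcosh
  have hsinh : 0 < Real.sinh (dist (e p) (e q)) := Real.sinh_pos_iff.2 h0
  rw [form_eq (e p) (e q), h, form_lin']
  nlinarith

theorem hasNonexpansiveReflections (hc : 0 < c)
    (he : ∀ x y, dist x y = c * dist (e x) (e y)) (r : ℝ≥0∞) :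
    HasNonexpansiveReflections X r := by
  have := properSpace_of_dist_eq_mul e hc he
  refine hasNonexpansiveReflections_of_pointReflection
    (fun x p => e.symm (pointReflection (e x) (e p))) ?_ ?_ ?_ ?_
  · intro x p _
    rcases eq_or_lt_of_le (dist_nonneg (x := e x) (y := e p)) with h0 | h0
    · obtain rfl : x = p := e.injective (dist_eq_zero.1 h0.symm)
      have hx : e.symm (pointReflection (e x) (e x)) = x := by
        rw [Equiv.symm_apply_eq]
        exact (eq_pointReflection (by simp) rfl).symm
      rw [hx]
      exact ⟨_, _, isGeodesic_const x, 0, by simp, rfl⟩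
    · obtain ⟨w, hw, hxw, hp⟩ := exists_direction (e x) (e p) h0
      have hg := isGeodesic_ray e hc he (e x) w hw hxw (l := 2 * dist (e x) (e p))
        (by positivity)
      rw [ray_two_mul_dist hw hxw hp, e.symm_apply_apply] at hg
      refine ⟨_, _, hg, c * dist (e x) (e p), ⟨by positivity, by gcongr; linarith⟩, ?_⟩
      simp only [mul_div_cancel_left₀ _ hc.ne']
      rw [Equiv.symm_apply_eq]
      exact ext_val hp.symm
  · intro x p z _
    rw [IsConvexComb, he, he, he, Equiv.eq_symm_apply]
    constructor
    · rintro ⟨h1, h2⟩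
      refine eq_pointReflection (mul_left_cancel₀ hc.ne' ?_) (mul_left_cancel₀ hc.ne' ?_) <;>
        linarith
    · intro hz
      rw [hz, dist_pointReflection_left, dist_pointReflection_right]
      constructor <;> ring
  · intro C hC x p q _ hp hq
    have hle := form_le_of_mem_projSet e hc he hC hp hq.1
    have hxq : dist x q = dist x p := hq.2.trans hp.2.symm
    rw [he, he] at hxq
    rw [form_eq (e x) (e q), mul_left_cancel₀ hc.ne' hxq, ← form_eq] at hle
    refine e.injective (dist_eq_zero.1 ?_)
    have h1 := one_le_neg_form (e p) (e q)
    rw [dist_def, Real.arcosh_eq_zero_iff h1]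
    -- Dividing by `-⟨x|p⟩ > 0` gives `-⟨p|q⟩ ≤ 1`, the reverse of `h1`.
    nlinarith [neg_form_pos (e x) (e p)]
  · intro C hC x y p q _ _ hp hq
    have h1 := form_le_of_mem_projSet e hc he hC hp hq.1
    have h2 := form_le_of_mem_projSet e hc he hC hq hp.1
    rw [he, he, e.apply_symm_apply, e.apply_symm_apply]
    refine mul_le_mul_of_nonneg_left ((Real.arcosh_le_arcosh (neg_form_pos _ _)
      (neg_form_pos _ _)).2 (neg_le_neg ?_)) hc.le
    simp only [pointReflection, form_lin, form_lin']
    rw [form_comm (e q).val (e p).val] at h2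
    rw [form_comm (e p).val (e y).val]
    -- As on the sphere, both products are at most `⟨x|p⟩⟨y|q⟩⟨p|q⟩`; no distance bound is needed
    -- for the signs.
    have h3 := mul_le_mul_of_nonneg_left h1 (neg_form_pos (e y) (e q)).le
    have h4 := mul_le_mul_of_nonneg_left h2 (neg_form_pos (e x) (e p)).le
    linarith

end Scaled

end HyperbolicSpace

/-! ### The model spaces -/

theorem modelSpace_hasNonexpansiveReflections (k : ℝ) (n : ℕ) :
    HasNonexpansiveReflections (ModelSpace k n) (modelDiam k / 2) := by
  -- Carrier and metric are exposed as projections of one bundle, so that the case distinction on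
  -- `k` rewrites both at once.
  change @HasNonexpansiveReflections (modelBundle k n).carrier (modelBundle k n).metric _
  rcases lt_trichotomy k 0 with hk | rfl | hk
  · have hc : 0 < 1 / √(-k) := one_div_pos.2 (Real.sqrt_pos.2 (neg_pos.2 hk))
    rw [modelBundle, dif_neg hk.not_gt, dif_pos hk]
    exact @HyperbolicSpace.hasNonexpansiveReflections n (HyperbolicSpace n)
      (scaledMetric inferInstance (1 / √(-k)) hc) (1 / √(-k)) (Equiv.refl _) hc
      (fun _ _ => rfl) _
  · rw [modelBundle, dif_neg (lt_irrefl _), dif_neg (lt_irrefl _)]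
    exact euclideanSpace_hasNonexpansiveReflections n _
  · have hr : modelDiam k / 2 = ENNReal.ofReal (1 / √k * (Real.pi / 2)) := by
      rw [modelDiam, if_pos hk, ← ENNReal.ofReal_ofNat 2,
        ← ENNReal.ofReal_div_of_pos two_pos]
      congr 1
      ring
    have hc : 0 < 1 / √k := one_div_pos.2 (Real.sqrt_pos.2 hk)
    rw [hr, modelBundle, dif_pos hk]
    exact @SphericalSpace.hasNonexpansiveReflections n (SphericalSpace n)
      (scaledMetric inferInstance (1 / √k) hc) (1 / √k) (Equiv.refl _) hc (fun _ _ => rfl)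

theorem mainTheorem1 (k : ℝ) (n : ℕ) (C : Set (ModelSpace k n))
    (hne : C.Nonempty) (hclosed : IsClosed C) (hconv : GeodesicConvex C) :
    ∃ P R : ModelSpace k n → ModelSpace k n,
      (∀ x ∈ nearSet C, projSet C x = {P x}) ∧
      (∀ x ∈ nearSet C, reflSet C x = {R x}) ∧
      (∀ x ∈ nearSet C, ∀ y ∈ nearSet C, dist (R x) (R y) ≤ dist x y) ∧
      IsAveragedOn (1 / 2) P (nearSet C) :=
  modelSpace_hasNonexpansiveReflections k n C hne hclosed hconv
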